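/- Let $F$ be a field of characteristic $p>0$, let $r\ge 1$, let $k_1\ge k_2\ge\cdots\ge k_{r+1}\ge 0$ be integers, and let $$\Phi(x_1,\ldots,x_{r+1})=\sum_{i=1}^{r+1}\sum_{j=0}^{k_i}c^{(i)}_j x_i^{p^j},\qquad c^{(i)}_j\in F,\quad c^{(i)}_{k_i}\ne 0\ \text{ for all } i,$$ be a separable $p$-polynomial, i.e. $c^{(i)}_0\neq 0$ for at least one $i$. Let $\mathsf U=V(\Phi)\subset\mathbb G_{a,F}^{r+1}$ be the smooth unipotent group defined by $\Phi$. If $p^{k_1}=2$, assume moreover that $\mathsf U$ is $F$-wound, in the sense that every $F$-morphism $\mathbb A^1_F\to\mathsf U$ is constant (so the statement holds in particular for every $F$-wound group $\mathsf U=V(\Phi)$ as above). Let $$\Phi^{\mathrm{pp}}=\sum_{i=1}^{r+1}c^{(i)}_{k_i}x_i^{p^{k_i}}$$ be the principal part of $\Phi$, and let $X$ be the weighted homogeneous compactification of $\mathsf U$, i.e. the hypersurface of degree $p^{k_1}$ given by $$\bar\Phi=\sum_{i=1}^{r+1}\sum_{j=0}^{k_i}c^{(i)}_j\,t_0^{\,p^{k_1}-p^{k_1-k_i+j}}\,t_i^{p^j}=0$$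 in the weighted projective space $\mathbb P(1,1,p^{k_1-k_2},\ldots,p^{k_1-k_{r+1}})$ over $F$ with coordinates $t_0,t_1,\ldots,t_{r+1}$. Then the following are equivalent: 1. the scheme $X$ is normal; 2. $\Phi^{\mathrm{pp}}$ is reduced over $F$, i.e. the ring $F[x_1,\ldots,x_{r+1}]/(\Phi^{\mathrm{pp}})$ is reduced; 3. $\Phi^{\mathrm{pp}}$ is irreducible in $F[x_1,\ldots,x_{r+1}]$. -/

import Mathlib

open CategoryTheory AlgebraicGeometry

universe u

noncomputable section

/-! ### The quotient of a graded algebra by a homogeneous ideal -/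

section QuotientGrading

variable {R A : Type u} [CommRing R] [CommRing A] [Algebra R A]

/-- The grading induced on `A ⧸ I`: its degree `n` part is the image of the degree `n` part
of `A`. -/
def quotientGrading (𝒜 : ℕ → Submodule R A) (I : Ideal A) (n : ℕ) : Submodule R (A ⧸ I) :=
  (𝒜 n).map (Ideal.Quotient.mkₐ R I).toLinearMap

theorem quotientGrading_gradedMonoid (𝒜 : ℕ → Submodule R A) [GradedAlgebra 𝒜] (I : Ideal A) :
    SetLike.GradedMonoid (quotientGrading 𝒜 I) where
  one_mem := ⟨1, SetLike.GradedOne.one_mem, map_one (Ideal.Quotient.mkₐ R I)⟩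
  mul_mem := by
    rintro i j _ _ ⟨a, ha, rfl⟩ ⟨b, hb, rfl⟩
    exact ⟨a * b, SetLike.GradedMul.mul_mem ha hb, map_mul (Ideal.Quotient.mkₐ R I) a b⟩

theorem quotientGrading_isInternal (𝒜 : ℕ → Submodule R A) [GradedAlgebra 𝒜] (I : Ideal A)
    (hI : I.IsHomogeneous 𝒜) : DirectSum.IsInternal (quotientGrading 𝒜 I) := by
  classical
  -- the projection in each degree
  let g : ∀ n, 𝒜 n →ₗ[R] quotientGrading 𝒜 I n := fun n =>
    ((Ideal.Quotient.mkₐ R I).toLinearMap.restrict fun a ha => ⟨a, ha, rfl⟩)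
  have hg : ∀ n, Function.Surjective (g n) := by
    rintro n ⟨_, a, ha, rfl⟩
    exact ⟨⟨a, ha⟩, rfl⟩
  have hcomm : ∀ x : DirectSum ℕ (fun n => 𝒜 n),
      DirectSum.coeAddMonoidHom (quotientGrading 𝒜 I) (DirectSum.lmap g x) =
        Ideal.Quotient.mk I (DirectSum.coeAddMonoidHom 𝒜 x) := by
    intro x
    induction x using DirectSum.induction_on with
    | zero => simp
    | of i a =>
      have : DirectSum.lmap g (DirectSum.of (fun n => 𝒜 n) i a) =
          DirectSum.of (fun n => quotientGrading 𝒜 I n) i (g i a) :=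
        DirectSum.lmap_lof (R := R) g i a
      rw [this, DirectSum.coeAddMonoidHom_of, DirectSum.coeAddMonoidHom_of]
      rfl
    | add x y hx hy => simp only [map_add, hx, hy]
  have hsurj : Function.Surjective (DirectSum.lmap g) := DirectSum.lmap_surjective g |>.2 hg
  constructor
  · rw [injective_iff_map_eq_zero]
    intro y hy
    obtain ⟨x, rfl⟩ := hsurj y
    rw [hcomm, Ideal.Quotient.eq_zero_iff_mem] at hy
    refine DFinsupp.ext fun n => ?_
    have h1 := hI n hy
    have h2 : DirectSum.decompose 𝒜 (DirectSum.coeAddMonoidHom 𝒜 x) = x :=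
      DirectSum.Decomposition.right_inv x
    rw [h2] at h1
    have : (DirectSum.lmap g x) n = g n (x n) := DirectSum.lmap_apply g x n
    rw [this]
    exact Subtype.ext (Ideal.Quotient.eq_zero_iff_mem.2 h1)
  · intro y
    obtain ⟨a, rfl⟩ := Ideal.Quotient.mk_surjective y
    refine ⟨DirectSum.lmap g (DirectSum.decompose 𝒜 a), ?_⟩
    rw [hcomm]
    congr 1
    exact DirectSum.Decomposition.left_inv a

/-- The quotient of a graded algebra by a homogeneous ideal is a graded algebra. -/
@[reducible]
def quotientGradedAlgebra (𝒜 : ℕ → Submodule R A) [GradedAlgebra 𝒜] (I : Ideal A)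
    (hI : I.IsHomogeneous 𝒜) : GradedAlgebra (quotientGrading 𝒜 I) :=
  { quotientGrading_gradedMonoid 𝒜 I with
    toDecomposition := (quotientGrading_isInternal 𝒜 I hI).chooseDecomposition }

end QuotientGrading

/-! ### Hypersurfaces in weighted projective spaces -/

/-- The hypersurface `f = 0` in the weighted projective space
`ℙ(q) = Proj F[t_i : i ∈ σ]`, `deg t_i = q i`, for `f` weighted homogeneous of degree `d`. -/
def weightedHypersurface {F : Type u} {σ : Type} [Field F] (q : σ → ℕ) (f : MvPolynomial σ F) (d : ℕ)
    (hf : MvPolynomial.IsWeightedHomogeneous q f d) : Scheme.{u} :=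
  letI := MvPolynomial.weightedGradedAlgebra F q
  letI := quotientGradedAlgebra (MvPolynomial.weightedHomogeneousSubmodule F q)
    (Ideal.span {f})
    (Ideal.homogeneous_span _ _ (by rintro _ rfl; exact ⟨d, hf⟩))
  Proj (quotientGrading (MvPolynomial.weightedHomogeneousSubmodule F q) (Ideal.span {f}))

/-! ### `p`-polynomials -/

section PPolynomial

open MvPolynomial

variable {F : Type u} [Field F] {r : ℕ} (p : ℕ) (k : Fin (r + 1) → ℕ) (c : Fin (r + 1) → ℕ → F)

/-- The `p`-polynomial `Φ = ∑ i, ∑ j ≤ k i, c i j * x_i ^ (p ^ j)` in `r + 1` variables. -/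
def pPolynomial : MvPolynomial (Fin (r + 1)) F :=
  ∑ i, ∑ j ∈ Finset.range (k i + 1), C (c i j) * X i ^ p ^ j

/-- The principal part `∑ i, c i (k i) * x_i ^ (p ^ k i)` of `pPolynomial p k c`. -/
def principalPart : MvPolynomial (Fin (r + 1)) F :=
  ∑ i, C (c i (k i)) * X i ^ p ^ k i

/-- The weights of `t_0, t_1, …, t_{r+1}`: the weight of `t_0` is `1`, and the variable `t_{i+1}`
(the homogeneous version of `x_i`, `i = 0, …, r`) has weight `p ^ (k 0 - k i)`. -/
def pWeight : Fin (r + 2) → ℕ :=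
  Fin.cons 1 fun i => p ^ (k 0 - k i)

/-- The weighted homogenization of `pPolynomial p k c` of degree `p ^ k 0`: each monomial
`x_i ^ (p ^ j)`, which has weight `p ^ (k 0 - k i + j)`, is multiplied by the power of `t_0` that
brings its weight up to `p ^ k 0`. -/
def pHomogenization : MvPolynomial (Fin (r + 2)) F :=
  ∑ i : Fin (r + 1), ∑ j ∈ Finset.range (k i + 1),
    C (c i j) * X 0 ^ (p ^ k 0 - p ^ (k 0 - k i + j)) * X i.succ ^ p ^ j

theorem pHomogenization_isWeightedHomogeneous [Fact p.Prime] (hk : Antitone k) :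
    IsWeightedHomogeneous (pWeight p k) (pHomogenization p k c) (p ^ k 0) := by
  refine IsWeightedHomogeneous.sum _ _ _ fun i _ => IsWeightedHomogeneous.sum _ _ _ fun j hj => ?_
  have hki : k i ≤ k 0 := hk (Fin.zero_le i)
  have hj' : j ≤ k i := Nat.lt_succ_iff.1 (Finset.mem_range.1 hj)
  have h0 : IsWeightedHomogeneous (pWeight p k) (X 0 : MvPolynomial (Fin (r + 2)) F) 1 :=
    isWeightedHomogeneous_X F (pWeight p k) 0
  have hi : IsWeightedHomogeneous (pWeight p k) (X i.succ : MvPolynomial (Fin (r + 2)) F)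
      (p ^ (k 0 - k i)) :=
    isWeightedHomogeneous_X F (pWeight p k) i.succ
  have h := ((h0.pow (p ^ k 0 - p ^ (k 0 - k i + j))).C_mul (c i j)).mul (hi.pow (p ^ j))
  have hle : p ^ (k 0 - k i + j) ≤ p ^ k 0 :=
    Nat.pow_le_pow_right (Fact.out : p.Prime).pos (by omega)
  have hdeg : (p ^ k 0 - p ^ (k 0 - k i + j)) • 1 + p ^ j • p ^ (k 0 - k i) = p ^ k 0 := by
    rw [smul_eq_mul, smul_eq_mul, mul_one, ← pow_add, add_comm j]
    omega
  rwa [hdeg] at h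

/-- The weighted homogeneous compactification of `V(Φ)`, `Φ = pPolynomial p k c` with
`k 0 ≥ k 1 ≥ ⋯ ≥ k r`: the hypersurface defined by the weighted homogenization of `Φ` in
`ℙ(1, 1, p ^ (k 0 - k 1), …, p ^ (k 0 - k r))`. -/
def weightedCompactification [Fact p.Prime] (hk : Antitone k) : Scheme.{u} :=
  weightedHypersurface (pWeight p k) (pHomogenization p k c) (p ^ k 0)
    (pHomogenization_isWeightedHomogeneous p k c hk)

end PPolynomial

/-! ### Normal schemes and wound groups -/

/-- A scheme is normal if all its local rings are integrally closed domains. -/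
def IsNormalScheme (Y : Scheme.{u}) : Prop :=
  ∀ y : Y, IsDomain (Y.presheaf.stalk y) ∧ IsIntegrallyClosed (Y.presheaf.stalk y)

/-- The condition on the affine `F`-scheme `U = Spec B` in the definition of an `F`-wound group:
every `F`-morphism `𝔸¹ → U` is constant, that is, it factors through the structure morphism
`𝔸¹ → Spec F`. -/
def IsWound (F B : Type u) [Field F] [CommRing B] [Algebra F B] : Prop :=
  ∀ f : Spec (.of (Polynomial F)) ⟶ Spec (.of B),
    f ≫ Spec.map (CommRingCat.ofHom (algebraMap F B)) =
      Spec.map (CommRingCat.ofHom (algebraMap F (Polynomial F))) →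
    ∃ s : Spec (.of F) ⟶ Spec (.of B),
      f = Spec.map (CommRingCat.ofHom (algebraMap F (Polynomial F))) ≫ s

end

/-! Everything rests on a dichotomy (`irreducible_or_isPthPower`): the principal part is either
irreducible or a nonzero constant times a `p`-th power. Up to a unit it is `X ^ p ^ n - B` in one
variable, which is reducible over the fraction field only if `n ≠ 0` and `B` is a `p`-th power. An
irreducible element of a factorial ring has reduced quotient and a `p`-th power does not, so
normality remains to be decided in the two cases.

Let `S` be the homogeneous coordinate ring, the quotient by the homogenization. If the principal
part is irreducible, then `S` is a domain and `t_0` is prime in it, because `S / t_0` is the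
quotient by the principal part. Choose `i` with `c i 0 ≠ 0`. Then `S = A[t_i]` for a polynomial ring
`A`, and the derivative of the minimal polynomial at `t_i` is a unit times a power of `t_0`. By
Euler's trace-dual formula that derivative multiplies every integral fraction into `S`, and
primality of `t_0` removes the denominator. So `S` is integrally closed, and `Proj S` is normal.

If the principal part is `a * G ^ p`, then `G ^ p = t_0 ^ N * H` in `S` (with `G` homogenized) for
`N = p ^ k 0 - p ^ (k 0 - 1)`. At a point with `t_0 = G = 0`, normality makes `t_0` divide `G ^ (p -
1)` locally once `N * (p - 1) ≥ p`; this is impossible modulo `t_0`, where only the `p`-th power of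
`G` is killed. The inequality fails only for `p ^ k 0 = 2`. There the group is given by a linear
form plus a constant times the square of a linear form, and it contains a nonconstant polynomial
curve, against woundness. -/

noncomputable section

/-! ### Integral closedness of monogenic extensions -/

section IntegrallyClosed

open Polynomial

/-- Removing a denominator which is a prime element from an integral fraction. -/
theorem exists_algebraMap_eq_of_prime_pow_mul {S L : Type*} [CommRing S] [IsDomain S] [Field L]
    [Algebra S L] [IsFractionRing S L] {t : S} (ht : Prime t) {y : L} (hy : IsIntegral S y) :
    ∀ (N : ℕ) (s : S), algebraMap S L (t ^ N) * y = algebraMap S L s →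
      ∃ a, algebraMap S L a = y := by
  have ht0 : algebraMap S L t ≠ 0 := by
    simpa using ht.ne_zero
  intro N
  induction N with
  | zero => intro s h; exact ⟨s, by simpa using h.symm⟩
  | succ N ih =>
    intro s h
    have h1 : IsIntegral S (algebraMap S L (t ^ N) * y) := isIntegral_algebraMap.mul hy
    obtain ⟨P, hP, hPy⟩ := h1
    -- The integral element `t ^ N * y` equals `s / t`; clearing denominators in its equation shows
    -- that `t` divides a power of `s`.
    have h2 := dvd_pow_natDegree_of_aeval_eq_zero hP t s _ hPy
      (by rw [← h, pow_succ, map_mul]; ring)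
    obtain ⟨a, rfl⟩ := ht.dvd_of_dvd_pow h2
    refine ih a (mul_left_cancel₀ ht0 ?_)
    rw [← map_mul, ← h, pow_succ, map_mul]
    ring

/-- If `S = A[x]` is a domain, `A` is integrally closed, and the derivative at `x` of the minimal
polynomial of `x` divides a power of a prime element of `S`, then `S` is integrally closed. -/
theorem isIntegrallyClosed_of_derivative_dvd_prime_pow {A S : Type*} [CommRing A] [IsDomain A]
    [IsIntegrallyClosed A] [CommRing S] [IsDomain S] [Algebra A S] [FaithfulSMul A S]
    {x : S} (hx : Algebra.adjoin A {x} = ⊤) (hxA : IsIntegral A x)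
    {t : S} (ht : Prime t) {N : ℕ} (hN : aeval x (derivative (minpoly A x)) ∣ t ^ N) :
    IsIntegrallyClosed S := by
  have hfin : Module.Finite A S := by
    have := hxA.fg_adjoin_singleton
    rw [hx] at this
    exact ⟨this⟩
  let K := FractionRing A
  let L := FractionRing S
  let : Algebra K L := FractionRing.liftAlgebra A L
  have : FiniteDimensional K L := .of_isLocalization A S (nonZeroDivisors A)
  set z : L := algebraMap S L x with hz
  have hzA : IsIntegral A z := hxA.map (IsScalarTower.toAlgHom A S L)
  have hd : aeval z (derivative (minpoly K z)) =
      algebraMap S L (aeval x (derivative (minpoly A x))) := by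
    rw [minpoly.isIntegrallyClosed_eq_field_fractions K L hxA, derivative_map,
      aeval_map_algebraMap, aeval_algebraMap_apply]
  have hd0 : aeval z (derivative (minpoly K z)) ≠ 0 := by
    rw [hd]
    intro h0
    rw [map_eq_zero_iff _ (IsFractionRing.injective S L)] at h0
    rw [h0, zero_dvd_iff] at hN
    exact ht.ne_zero (eq_zero_of_pow_eq_zero hN)
  have hmem : ∀ s : S, algebraMap S L s ∈ Algebra.adjoin A {z} := by
    intro s
    have : s ∈ Algebra.adjoin A {x} := hx ▸ Algebra.mem_top
    have h2 := (Algebra.adjoin A {x}).mem_map (f := IsScalarTower.toAlgHom A S L) |>.2 ⟨s, this, rfl⟩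
    rw [AlgHom.map_adjoin_singleton] at h2
    exact h2
  have htop' : IntermediateField.adjoin K {z} = ⊤ := by
    rw [eq_top_iff]
    intro l _
    have h3 : ∀ s : S, algebraMap S L s ∈ IntermediateField.adjoin K {z} := fun s =>
      (Algebra.adjoin_le (S := (IntermediateField.adjoin K {z}).toSubalgebra.restrictScalars A)
        (by rintro _ rfl; exact IntermediateField.mem_adjoin_simple_self K z)) (hmem s)
    obtain ⟨a, b, -, rfl⟩ := IsFractionRing.div_surjective (A := S) l
    exact div_mem (h3 a) (h3 b)
  have htop : Algebra.adjoin K {z} = ⊤ := by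
    rw [← IntermediateField.adjoin_simple_toSubalgebra_of_isAlgebraic
      (hzA.tower_top (A := K)).isAlgebraic, htop', IntermediateField.top_toSubalgebra]
  have hsep : Algebra.IsSeparable K L := by
    have hzs : IsSeparable K z := by
      rw [IsSeparable, separable_iff_derivative_ne_zero (minpoly.irreducible (hzA.tower_top))]
      intro h0
      rw [h0] at hd0
      simp at hd0
    rw [← separableClosure.eq_top_iff, eq_top_iff, ← htop',
      IntermediateField.adjoin_simple_le_iff]
    exact mem_separableClosure_iff.2 hzs
  refine (isIntegrallyClosed_iff L).2 fun {y} hy => ?_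
  -- Traces of integral elements lie in `A`, so an integral `y` lies in the trace dual of `A[z]`. By
  -- Euler's formula this dual is `A[z]` divided by the derivative of the minimal polynomial at `z`.
  have hdual : y ∈ (Algebra.traceForm K L).dualSubmodule
      (Subalgebra.toSubmodule (Algebra.adjoin A {z})) := by
    intro w hw
    have hw' : IsIntegral A w := adjoin_le_integralClosure hzA hw
    have : Algebra.IsIntegral A S := inferInstance
    have hy' : IsIntegral A y := isIntegral_trans y hy
    have := Algebra.isIntegral_trace (L := K) (F := L) (hy'.mul hw')
    obtain ⟨a, ha⟩ := IsIntegrallyClosed.isIntegral_iff.1 this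
    rw [Submodule.mem_one]
    exact ⟨a, ha⟩
  rw [traceForm_dualSubmodule_adjoin A K htop hzA] at hdual
  obtain ⟨w, hw, hwy⟩ := hdual
  obtain ⟨s, rfl⟩ : ∃ s : S, algebraMap S L s = w := by
    have : w ∈ (Algebra.adjoin A {x}).map (IsScalarTower.toAlgHom A S L) := by
      rw [AlgHom.map_adjoin_singleton]; exact hw
    obtain ⟨s, -, hs⟩ := this
    exact ⟨s, hs⟩
  obtain ⟨v, hv⟩ := hN
  refine exists_algebraMap_eq_of_prime_pow_mul ht hy N (v * s) ?_
  rw [hv, map_mul, ← hd, ← hwy, map_mul]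
  simp only [DistribSMul.toLinearMap_apply, smul_eq_mul]
  rw [mul_mul_mul_comm, mul_inv_cancel₀ hd0, one_mul]

end IntegrallyClosed

/-! ### Purely inseparable binomials -/

section PurelyInseparable

open Polynomial

/-- `X ^ p ^ n - a` is irreducible in characteristic `p` if `a` is not a `p`-th power. -/
theorem irreducible_X_pow_char_pow_sub_C {K : Type*} [Field K] (p : ℕ) [Fact p.Prime] [CharP K p]
    (n : ℕ) {a : K} (ha : n = 0 ∨ ∀ b, b ^ p ≠ a) : Irreducible (X ^ p ^ n - C a : K[X]) := by
  have : ExpChar K p := .prime Fact.out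
  have hpos : p ^ n ≠ 0 := pow_ne_zero _ (Fact.out : p.Prime).ne_zero
  have hmon : (X ^ p ^ n - C a : K[X]).Monic := monic_X_pow_sub_C a hpos
  have hdeg : (X ^ p ^ n - C a : K[X]).natDegree = p ^ n := natDegree_X_pow_sub_C
  obtain ⟨g, hg, hgi, hgd⟩ := exists_monic_irreducible_factor (X ^ p ^ n - C a : K[X])
    (fun h => by rw [natDegree_eq_zero_of_isUnit h] at hdeg; exact hpos hdeg.symm)
  -- The binomial has separable degree one, hence so does its irreducible factor `g`, which must
  -- then be some `X ^ p ^ m - b`. Comparing at a common root gives `a = b ^ p ^ (n - m)`.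
  have hsd : g.natSepDegree = 1 := by
    have h1 := natSepDegree_le_of_dvd _ _ hgd hmon.ne_zero
    rw [natSepDegree_X_pow_char_pow_sub_C] at h1
    have h2 := g.natSepDegree_ne_zero hgi.natDegree_pos.ne'
    omega
  obtain ⟨m, b, -, hgb⟩ := hg.eq_X_pow_char_pow_sub_C_of_natSepDegree_eq_one_of_irreducible p hgi hsd
  have hmd : g.natDegree = p ^ m := by rw [hgb, natDegree_X_pow_sub_C]
  have hmn : m ≤ n := by
    have := natDegree_le_of_dvd hgd hmon.ne_zero
    rw [hmd, hdeg] at this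
    exact (Nat.pow_le_pow_iff_right (Fact.out : p.Prime).one_lt).1 this
  obtain ⟨x, hx⟩ := IsAlgClosed.exists_aeval_eq_zero (AlgebraicClosure K) g (hgi.degree_pos.ne')
  have hxb : x ^ p ^ m = algebraMap K _ b := by
    rw [hgb] at hx; simpa [sub_eq_zero] using hx
  have hxa : x ^ p ^ n = algebraMap K _ a := by
    have := aeval_eq_zero_of_dvd_aeval_eq_zero hgd hx
    simpa [sub_eq_zero] using this
  have hab : a = b ^ p ^ (n - m) := by
    apply FaithfulSMul.algebraMap_injective K (AlgebraicClosure K)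
    rw [map_pow, ← hxb, ← hxa, ← pow_mul, ← pow_add, Nat.add_sub_cancel' hmn]
  have hnm : n - m = 0 := by
    rcases ha with h | h
    · omega
    · by_contra h0
      obtain ⟨l, hl⟩ := Nat.exists_eq_succ_of_ne_zero h0
      exact h (b ^ p ^ l) (by rw [hab, hl, ← pow_mul, pow_succ])
  have : n = m := by omega
  subst this
  rw [hnm, pow_zero, pow_one] at hab
  rwa [hab, ← hgb]

end PurelyInseparable

/-! ### Homogeneous localizations and normality of `Proj` -/

section Graded

/-- A subring of an integrally closed domain that reflects divisibility is integrally closed. -/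
theorem IsIntegrallyClosed.of_injective_of_dvd {L M : Type*} [CommRing L] [IsDomain L] [CommRing M]
    [IsDomain M] [IsIntegrallyClosed M] (f : L →+* M) (hf : Function.Injective f)
    (hdvd : ∀ a b : L, f b ∣ f a → b ∣ a) : IsIntegrallyClosed L := by
  refine (isIntegrallyClosed_iff (FractionRing L)).2 fun {y} hy => ?_
  obtain ⟨a, b, hb, rfl⟩ := IsFractionRing.div_surjective (A := L) y
  have hb0 : b ≠ 0 := nonZeroDivisors.ne_zero hb
  let g : FractionRing L →+* FractionRing M := IsFractionRing.map hf
  have hg : ∀ l, g (algebraMap L _ l) = algebraMap M _ (f l) := fun l =>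
    IsLocalization.map_eq _ l
  have h1 : IsIntegral M (g (algebraMap L _ a / algebraMap L _ b)) :=
    hy.map_of_comp_eq f g (by ext l; exact (hg l).symm)
  obtain ⟨m, hm⟩ := IsIntegrallyClosed.isIntegral_iff.1 h1
  have hb1 : algebraMap M (FractionRing M) (f b) ≠ 0 := by
    rw [Ne, FaithfulSMul.algebraMap_eq_zero_iff, map_eq_zero_iff f hf]; exact hb0
  have hb2 : algebraMap L (FractionRing L) b ≠ 0 := by
    rw [Ne, FaithfulSMul.algebraMap_eq_zero_iff]; exact hb0
  rw [map_div₀, hg, hg, eq_div_iff hb1, ← map_mul] at hm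
  obtain ⟨l, rfl⟩ := hdvd a b ⟨m, by
    rw [← FaithfulSMul.algebraMap_injective M (FractionRing M) hm, mul_comm]⟩
  exact ⟨l, by rw [map_mul, mul_div_cancel_left₀ _ hb2]⟩

variable {R A : Type u} [CommRing R] [CommRing A] [Algebra R A] (𝒜 : ℕ → Submodule R A)
  [GradedAlgebra 𝒜]

theorem HomogeneousLocalization.isDomain_atPrime [IsDomain A] (P : Ideal A) [P.IsPrime] :
    IsDomain (HomogeneousLocalization.AtPrime 𝒜 P) :=
  have : IsDomain (Localization.AtPrime P) :=
    IsLocalization.isDomain_localization P.primeCompl_le_nonZeroDivisors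
  (HomogeneousLocalization.val_injective (𝒜 := 𝒜) P.primeCompl).isDomain
    (algebraMap (HomogeneousLocalization.AtPrime 𝒜 P) (Localization.AtPrime P))

open HomogeneousLocalization in
/-- Degree zero fractions of the same degree divide each other in the homogeneous localization at
a homogeneous prime if they do in the localization. -/
theorem HomogeneousLocalization.dvd_of_val_dvd [IsDomain A] (P : Ideal A) [P.IsPrime]
    (a b : HomogeneousLocalization.AtPrime 𝒜 P)
    (h : b.val ∣ a.val) : b ∣ a := by
  obtain ⟨⟨i, n₁, d₁, hd₁⟩, rfl⟩ := HomogeneousLocalization.mk_surjective a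
  obtain ⟨⟨j, n₂, d₂, hd₂⟩, rfl⟩ := HomogeneousLocalization.mk_surjective b
  obtain ⟨y, hy⟩ := h
  obtain ⟨s, u, rfl⟩ := IsLocalization.exists_mk'_eq P.primeCompl y
  simp only [HomogeneousLocalization.val_mk, Localization.mk_eq_mk'] at hy
  have hy' : (n₁ : A) * (d₂ * u) = d₁ * (n₂ * s) := by
    rw [← IsLocalization.mk'_mul, IsLocalization.mk'_eq_iff_eq] at hy
    have := IsLocalization.injective (Localization.AtPrime P)
      P.primeCompl_le_nonZeroDivisors hy
    simp only [Submonoid.coe_mul] at this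
    linear_combination this
  classical
  -- The quotient `s / u` need not be homogeneous. Some component of `u` avoids `P`, and taking
  -- components of degree `l` in both `s` and `u` preserves the relation, as the other factors are
  -- homogeneous of equal degree.
  obtain ⟨l, hl⟩ : ∃ l, (DirectSum.decompose 𝒜 (u : A) l : A) ∉ P := by
    by_contra! hall
    refine u.2 ?_
    change (u : A) ∈ P
    rw [← DirectSum.sum_support_decompose 𝒜 (u : A)]
    exact P.sum_mem fun l _ => hall l
  have hα : (n₁ * d₂ : A) ∈ 𝒜 (i + j) := SetLike.mul_mem_graded n₁.2 d₂.2
  have hβ : (d₁ * n₂ : A) ∈ 𝒜 (i + j) := SetLike.mul_mem_graded d₁.2 n₂.2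
  have hcomp : (n₁ * d₂ : A) * DirectSum.decompose 𝒜 (u : A) l =
      (d₁ * n₂ : A) * DirectSum.decompose 𝒜 (s : A) l := by
    rw [← DirectSum.coe_decompose_mul_add_of_left_mem 𝒜 hα,
      ← DirectSum.coe_decompose_mul_add_of_left_mem 𝒜 hβ, mul_assoc, mul_assoc, hy']
  refine ⟨HomogeneousLocalization.mk ⟨l, DirectSum.decompose 𝒜 (s : A) l,
    DirectSum.decompose 𝒜 (u : A) l, hl⟩, HomogeneousLocalization.val_injective P.primeCompl ?_⟩
  rw [HomogeneousLocalization.val_mul]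
  simp only [HomogeneousLocalization.val_mk, Localization.mk_eq_mk']
  rw [← IsLocalization.mk'_mul, IsLocalization.mk'_eq_iff_eq]
  congr 1
  simp only [Submonoid.coe_mul]
  linear_combination hcomp

theorem HomogeneousLocalization.isIntegrallyClosed_atPrime [IsDomain A] [IsIntegrallyClosed A]
    (P : Ideal A) [P.IsPrime] : IsIntegrallyClosed (HomogeneousLocalization.AtPrime 𝒜 P) := by
  have h1 : IsDomain (Localization.AtPrime P) :=
    IsLocalization.isDomain_localization P.primeCompl_le_nonZeroDivisors
  have h2 : IsIntegrallyClosed (Localization.AtPrime P) :=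
    isIntegrallyClosed_of_isLocalization _ P.primeCompl P.primeCompl_le_nonZeroDivisors
  have h3 := isDomain_atPrime 𝒜 P
  exact .of_injective_of_dvd
    (algebraMap (HomogeneousLocalization.AtPrime 𝒜 P) (Localization.AtPrime P))
    (HomogeneousLocalization.val_injective (𝒜 := 𝒜) P.primeCompl)
    (dvd_of_val_dvd 𝒜 P)

end Graded

/-- `Proj` of an integrally closed graded domain is normal. -/
theorem isNormalScheme_proj {R A : Type u} [CommRing R] [CommRing A] [Algebra R A]
    (𝒜 : ℕ → Submodule R A) [GradedAlgebra 𝒜] [IsDomain A] [IsIntegrallyClosed A] :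
    IsNormalScheme (Proj 𝒜) := by
  intro y
  have e := (Proj.stalkIso 𝒜 y).commRingCatIsoToRingEquiv.symm
  have h0 : y.asHomogeneousIdeal.toIdeal.IsPrime := ProjectiveSpectrum.isPrime y
  have h1 := HomogeneousLocalization.isDomain_atPrime 𝒜 y.asHomogeneousIdeal.toIdeal
  have h2 := HomogeneousLocalization.isIntegrallyClosed_atPrime 𝒜 y.asHomogeneousIdeal.toIdeal
  exact ⟨e.symm.toMulEquiv.isDomain _, .of_equiv e⟩

/-- If `Proj` is normal, then the homogeneous localizations at its points are integrally closed
domains. -/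
theorem IsNormalScheme.homogeneousLocalization {R A : Type u} [CommRing R] [CommRing A]
    [Algebra R A] (𝒜 : ℕ → Submodule R A) [GradedAlgebra 𝒜] (h : IsNormalScheme (Proj 𝒜))
    (P : Ideal A) [P.IsPrime] (hP : P.IsHomogeneous 𝒜)
    (hirr : ¬ (HomogeneousIdeal.irrelevant 𝒜).toIdeal ≤ P) :
    IsDomain (HomogeneousLocalization.AtPrime 𝒜 P) ∧
      IsIntegrallyClosed (HomogeneousLocalization.AtPrime 𝒜 P) := by
  let y : Proj 𝒜 := (⟨⟨P, hP⟩, ‹P.IsPrime›, hirr⟩ : ProjectiveSpectrum 𝒜)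
  obtain ⟨h1, h2⟩ := h y
  have e : ((Proj 𝒜).presheaf.stalk y) ≃+* HomogeneousLocalization.AtPrime 𝒜 P :=
    (Proj.stalkIso 𝒜 y).commRingCatIsoToRingEquiv
  exact ⟨e.symm.toMulEquiv.isDomain _, .of_equiv e⟩

/-! ### Isolating a variable and setting `t_0 = 0` -/

section Isolate

open MvPolynomial

variable {F : Type u} [Field F]

/-- Viewing a polynomial in `n + 1` variables as a polynomial in the `i`-th variable. -/
def isolate (F : Type u) [Field F] {n : ℕ} (i : Fin (n + 1)) :
    MvPolynomial (Fin (n + 1)) F ≃ₐ[F] Polynomial (MvPolynomial (Fin n) F) :=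
  (renameEquiv F (_root_.finSuccEquiv' i)).trans (optionEquivLeft F (Fin n))

@[simp] theorem isolate_X_self {n : ℕ} (i : Fin (n + 1)) : isolate F i (X i) = Polynomial.X := by
  simp [isolate]

@[simp] theorem isolate_X_succAbove {n : ℕ} (i : Fin (n + 1)) (j : Fin n) :
    isolate F i (X (i.succAbove j)) = Polynomial.C (X j) := by
  simp [isolate]

@[simp] theorem isolate_succ_X_zero {n : ℕ} (i : Fin (n + 1)) :
    isolate F i.succ (X 0) = Polynomial.C (X 0) := by
  have h := isolate_X_succAbove (F := F) i.succ 0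
  rwa [show i.succ.succAbove 0 = 0 by simp] at h

@[simp] theorem isolate_succ_X_succAbove_succ {n : ℕ} (i : Fin (n + 1)) (j : Fin n) :
    isolate F i.succ (X (i.succAbove j).succ) = Polynomial.C (X j.succ) := by
  rw [← Fin.succ_succAbove_succ, isolate_X_succAbove]

@[simp] theorem isolate_C {n : ℕ} (i : Fin (n + 1)) (a : F) :
    isolate F i (C a) = Polynomial.C (C a) :=
  (isolate F i).commutes a

/-- Setting the first variable equal to zero. -/
def killZero (F : Type u) [Field F] (n : ℕ) :
    MvPolynomial (Fin (n + 1)) F →ₐ[F] MvPolynomial (Fin n) F :=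
  aeval (Fin.cons 0 X)

@[simp] theorem killZero_X_zero (n : ℕ) : killZero F n (X 0) = 0 := by simp [killZero]

@[simp] theorem killZero_X_succ {n : ℕ} (i : Fin n) : killZero F n (X i.succ) = X i := by
  simp [killZero]

@[simp] theorem killZero_C (n : ℕ) (a : F) : killZero F n (C a) = C a :=
  (killZero F n).commutes a

theorem killZero_surjective (n : ℕ) : Function.Surjective (killZero F n) := by
  intro f
  refine ⟨rename Fin.succ f, ?_⟩
  have : (killZero F n).comp (rename Fin.succ) = AlgHom.id F _ := by
    ext i; simp
  exact DFunLike.congr_fun this f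

/-- Setting the first variable to zero and re-embedding is the identity modulo that variable. -/
theorem X_zero_dvd_of_killZero_eq_zero {n : ℕ} {f : MvPolynomial (Fin (n + 1)) F}
    (hf : killZero F n f = 0) : X 0 ∣ f := by
  have h : (Ideal.Quotient.mkₐ F (Ideal.span {(X 0 : MvPolynomial (Fin (n + 1)) F)})).comp
      ((rename Fin.succ).comp (killZero F n)) = Ideal.Quotient.mkₐ F _ := by
    ext i
    refine Fin.cases ?_ (fun i => ?_) i
    · simp only [AlgHom.comp_apply, killZero_X_zero, map_zero]
      exact (Ideal.Quotient.eq_zero_iff_mem.2 (Ideal.mem_span_singleton_self _)).symm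
    · simp
  have h1 := DFunLike.congr_fun h f
  simp only [AlgHom.comp_apply, hf, map_zero] at h1
  exact Ideal.mem_span_singleton.1 (Ideal.Quotient.eq_zero_iff_mem.1 h1.symm)

theorem isolate_killZero {n : ℕ} (i : Fin (n + 1)) (f : MvPolynomial (Fin (n + 2)) F) :
    isolate F i (killZero F (n + 1) f) =
      (isolate F i.succ f).map (killZero F n : MvPolynomial (Fin (n + 1)) F →+* _) := by
  have h : (isolate F i : _ →ₐ[F] _).comp (killZero F (n + 1)) =
      (Polynomial.mapAlgHom (killZero F n)).comp (isolate F i.succ : _ →ₐ[F] _) := by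
    ext j : 1
    refine Fin.cases ?_ (fun j => ?_) j
    · simp
    · refine Fin.succAboveCases i ?_ (fun j => ?_) j <;> simp
  exact DFunLike.congr_fun h f

end Isolate

/-! ### The homogenization as a polynomial in one variable -/

section PPolynomial

open MvPolynomial

variable {F : Type u} [Field F] {r : ℕ} (p : ℕ) (k : Fin (r + 1) → ℕ)
  (c : Fin (r + 1) → ℕ → F)

/-- Only the terms with `j = k i` have exponent zero at `t_0`. -/
theorem killZero_pHomogenization [Fact p.Prime] (hk : Antitone k) :
    killZero F (r + 1) (pHomogenization p k c) = principalPart p k c := by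
  rw [pHomogenization, principalPart, map_sum]
  refine Finset.sum_congr rfl fun i _ => ?_
  have hki : k i ≤ k 0 := hk (Fin.zero_le i)
  rw [Finset.sum_range_succ, map_add, map_sum, Finset.sum_eq_zero, zero_add]
  · simp [Nat.sub_add_cancel hki]
  · intro j hj
    have hj := Finset.mem_range.1 hj
    have : p ^ (k 0 - k i + j) < p ^ k 0 :=
      Nat.pow_lt_pow_right (Fact.out : p.Prime).one_lt (by omega)
    have h0 : p ^ k 0 - p ^ (k 0 - k i + j) ≠ 0 := by omega
    simp [h0]

theorem isolate_pHomogenization (i : Fin (r + 1)) :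
    ∃ b : MvPolynomial (Fin (r + 1)) F, isolate F i.succ (pHomogenization p k c) =
      ∑ j ∈ Finset.range (k i + 1), Polynomial.C (C (c i j) *
        X 0 ^ (p ^ k 0 - p ^ (k 0 - k i + j))) * Polynomial.X ^ p ^ j + Polynomial.C b := by
  refine ⟨∑ l : Fin r, ∑ j ∈ Finset.range (k (i.succAbove l) + 1), C (c (i.succAbove l) j) *
    X 0 ^ (p ^ k 0 - p ^ (k 0 - k (i.succAbove l) + j)) * X l.succ ^ p ^ j, ?_⟩
  rw [pHomogenization, map_sum, Fin.sum_univ_succAbove _ i]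
  simp only [map_sum, map_mul, map_pow, isolate_succ_X_zero, isolate_succ_X_succAbove_succ,
    isolate_C, isolate_X_self]

/-- As a polynomial in a variable `x_i`, the homogenization is monic up to a constant. -/
theorem exists_monic_isolate_pHomogenization [Fact p.Prime] [CharP F p] (hk : Antitone k) (i : Fin (r + 1))
    (hc : c i (k i) ≠ 0) :
    ∃ P : Polynomial (MvPolynomial (Fin (r + 1)) F), P.Monic ∧ P.natDegree ≠ 0 ∧
      isolate F i.succ (pHomogenization p k c) = Polynomial.C (C (c i (k i))) * P ∧
      P.derivative = Polynomial.C (C ((c i (k i))⁻¹ * c i 0) *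
        X 0 ^ (p ^ k 0 - p ^ (k 0 - k i))) := by
  obtain ⟨b, hb⟩ := isolate_pHomogenization p k c i
  have hki : k i ≤ k 0 := hk (Fin.zero_le i)
  have hp1 := (Fact.out : p.Prime).one_lt
  obtain ⟨Q, hQ⟩ : ∃ Q : Polynomial (MvPolynomial (Fin (r + 1)) F),
    Q = ∑ j ∈ Finset.range (k i), Polynomial.C (C (c i j) *
        X 0 ^ (p ^ k 0 - p ^ (k 0 - k i + j))) * Polynomial.X ^ p ^ j + Polynomial.C b := ⟨_, rfl⟩
  have hb' : isolate F i.succ (pHomogenization p k c) =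
      Polynomial.C (C (c i (k i))) * Polynomial.X ^ p ^ k i + Q := by
    rw [hb, Finset.sum_range_succ, hQ, Nat.sub_add_cancel hki, Nat.sub_self, pow_zero, mul_one]
    ring
  have hQd : Q.degree < ((p ^ k i : ℕ) : WithBot ℕ) := by
    rw [hQ, ← Polynomial.mem_degreeLT]
    refine add_mem (sum_mem fun j hj => ?_) ?_
    · rw [Polynomial.mem_degreeLT]
      refine (Polynomial.degree_C_mul_X_pow_le _ _).trans_lt ?_
      exact_mod_cast Nat.pow_lt_pow_right hp1 (Finset.mem_range.1 hj)
    · rw [Polynomial.mem_degreeLT]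
      refine Polynomial.degree_C_le.trans_lt ?_
      exact_mod_cast Nat.pow_pos (by omega)
  have hu : (C (c i (k i)) : MvPolynomial (Fin (r + 1)) F) * C ((c i (k i))⁻¹) = 1 := by
    rw [← C_mul, mul_inv_cancel₀ hc, C_1]
  have hdeg : (Polynomial.C (C ((c i (k i))⁻¹)) * Q).degree < ((p ^ k i : ℕ) : WithBot ℕ) := by
    rwa [Polynomial.degree_C_mul (by simpa using hc)]
  refine ⟨Polynomial.X ^ p ^ k i + Polynomial.C (C ((c i (k i))⁻¹)) * Q,
    Polynomial.monic_X_pow_add hdeg, ?_, ?_, ?_⟩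
  · rw [Polynomial.natDegree_eq_of_degree_eq_some (n := p ^ k i)]
    · exact pow_ne_zero _ (by omega)
    · rw [Polynomial.degree_add_eq_left_of_degree_lt (by rwa [Polynomial.degree_X_pow]),
        Polynomial.degree_X_pow]
  · rw [hb', mul_add, ← mul_assoc, ← Polynomial.C_mul, hu, Polynomial.C_1, one_mul]
  · have hP : Polynomial.X ^ p ^ k i + Polynomial.C (C ((c i (k i))⁻¹)) * Q =
        Polynomial.C (C ((c i (k i))⁻¹)) * (∑ j ∈ Finset.range (k i + 1), Polynomial.C (C (c i j) *
        X 0 ^ (p ^ k 0 - p ^ (k 0 - k i + j))) * Polynomial.X ^ p ^ j + Polynomial.C b) := by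
      rw [← hb, hb', mul_add, ← mul_assoc, ← Polynomial.C_mul, mul_comm (C _) (C _), hu,
        Polynomial.C_1, one_mul]
    -- In characteristic `p` only the term `j = 0` has a nonzero derivative.
    rw [hP, Polynomial.derivative_C_mul, Polynomial.derivative_add, Polynomial.derivative_C,
      add_zero, Polynomial.derivative_sum, Finset.sum_range_succ', Finset.sum_eq_zero, zero_add]
    · rw [pow_zero, pow_one, add_zero, Polynomial.derivative_C_mul, Polynomial.derivative_X, mul_one,
        ← Polynomial.C_mul, ← mul_assoc, ← C_mul]
    · intro j _
      rw [Polynomial.derivative_C_mul, Polynomial.derivative_X_pow]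
      have : ((p ^ (j + 1) : ℕ) : MvPolynomial (Fin (r + 1)) F) = 0 := by
        simp [CharP.cast_eq_zero]
      rw [this]; simp

/-- A monic polynomial over a domain is irreducible if its reduction is; here the reduction sets
`t_0 = 0`, and the factor making it monic is a unit. -/
theorem irreducible_pHomogenization [Fact p.Prime] [CharP F p] (hk : Antitone k) (hc : ∀ i, c i (k i) ≠ 0)
    (h : Irreducible (principalPart p k c)) : Irreducible (pHomogenization p k c) := by
  obtain ⟨P, hP, -, hPe, -⟩ := exists_monic_isolate_pHomogenization p k c hk 0 (hc 0)
  have hu (n : ℕ) : IsUnit (Polynomial.C (C (c 0 (k 0))) : Polynomial (MvPolynomial (Fin n) F)) :=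
    (((hc 0).isUnit.map C).map Polynomial.C)
  rw [← killZero_pHomogenization p k c hk, ← MulEquiv.irreducible_iff (isolate F 0),
    isolate_killZero, hPe, Polynomial.map_mul, Polynomial.map_C] at h
  rw [← MulEquiv.irreducible_iff (isolate F (Fin.succ 0)), hPe, irreducible_isUnit_mul (hu _)]
  refine hP.irreducible_of_irreducible_map
    (killZero F r : MvPolynomial (Fin (r + 1)) F →+* MvPolynomial (Fin r) F) _ ?_
  rw [RingHom.coe_coe, killZero_C, irreducible_isUnit_mul (hu _)] at h
  exact h

end PPolynomial

/-! ### Irreducible principal part implies normality -/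

section NormalCase

open MvPolynomial

variable {F : Type u} [Field F] {r : ℕ} (p : ℕ) [Fact p.Prime] [CharP F p] (k : Fin (r + 1) → ℕ)
  (c : Fin (r + 1) → ℕ → F)

/-- Divisibility by `t_0` in the quotient amounts to divisibility by the principal part after
setting `t_0 = 0`, and the principal part is prime. -/
theorem prime_mk_X_zero (hk : Antitone k) (hc : ∀ i, c i (k i) ≠ 0)
    (h : Irreducible (principalPart p k c)) :
    Prime (Ideal.Quotient.mk (Ideal.span {pHomogenization p k c}) (X 0)) := by
  have hpp : Prime (principalPart p k c) := h.prime
  have hdvd : ∀ f : MvPolynomial (Fin (r + 2)) F,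
      Ideal.Quotient.mk (Ideal.span {pHomogenization p k c}) (X 0) ∣ Ideal.Quotient.mk _ f ↔
        principalPart p k c ∣ killZero F (r + 1) f := by
    intro f
    constructor
    · rintro ⟨g, hg⟩
      obtain ⟨g, rfl⟩ := Ideal.Quotient.mk_surjective g
      rw [← map_mul, Ideal.Quotient.eq, Ideal.mem_span_singleton] at hg
      obtain ⟨v, hv⟩ := hg
      refine ⟨killZero F (r + 1) v, ?_⟩
      have := congr_arg (killZero F (r + 1)) hv
      simpa [killZero_pHomogenization p k c hk] using this
    · rintro ⟨v, hv⟩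
      obtain ⟨v, rfl⟩ := killZero_surjective _ v
      obtain ⟨w, hw⟩ : X 0 ∣ f - pHomogenization p k c * v :=
        X_zero_dvd_of_killZero_eq_zero (by
          rw [map_sub, map_mul, killZero_pHomogenization p k c hk, hv, sub_self])
      refine ⟨Ideal.Quotient.mk _ w, ?_⟩
      rw [← map_mul, Ideal.Quotient.eq, Ideal.mem_span_singleton]
      exact ⟨v, by rw [← hw]; ring⟩
  refine ⟨fun h0 => ?_, fun hu => ?_, fun a b hab => ?_⟩
  -- If the homogenization divided `t_0`, the cofactor would vanish at `t_0 = 0`; cancelling `t_0`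
  -- would make the homogenization a unit.
  · rw [Ideal.Quotient.eq_zero_iff_mem, Ideal.mem_span_singleton] at h0
    obtain ⟨v, hv⟩ := h0
    have h1 := congr_arg (killZero F (r + 1)) hv
    rw [killZero_X_zero, map_mul, killZero_pHomogenization p k c hk, eq_comm,
      mul_eq_zero_iff_left hpp.ne_zero] at h1
    obtain ⟨w, rfl⟩ := X_zero_dvd_of_killZero_eq_zero h1
    refine (irreducible_pHomogenization p k c hk hc h).not_isUnit (IsUnit.of_mul_eq_one w ?_)
    refine mul_left_cancel₀ (X_ne_zero (R := F) (0 : Fin (r + 2))) ?_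
    linear_combination -hv
  · have := (hdvd 1).1 hu.dvd
    rw [map_one] at this
    exact hpp.not_isUnit (isUnit_of_dvd_one this)
  · obtain ⟨a, rfl⟩ := Ideal.Quotient.mk_surjective a
    obtain ⟨b, rfl⟩ := Ideal.Quotient.mk_surjective b
    rw [← map_mul, hdvd, map_mul] at hab
    rw [hdvd, hdvd]
    exact hpp.dvd_or_dvd hab

theorem isDomain_quotient_pHomogenization (hk : Antitone k) (hc : ∀ i, c i (k i) ≠ 0)
    (h : Irreducible (principalPart p k c)) :
    IsDomain (MvPolynomial (Fin (r + 2)) F ⧸ Ideal.span {pHomogenization p k c}) := by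
  have hi := irreducible_pHomogenization p k c hk hc h
  have := (Ideal.span_singleton_prime hi.ne_zero).2 hi.prime
  infer_instance

/-- Separability supplies a variable whose derivative is a unit times a power of `t_0`; the quotient
is then `AdjoinRoot P` with `P` monic, irreducible, hence the minimal polynomial of its root. -/
theorem isIntegrallyClosed_quotient_pHomogenization (hk : Antitone k) (hc : ∀ i, c i (k i) ≠ 0)
    (hsep : ∃ i, c i 0 ≠ 0) (h : Irreducible (principalPart p k c)) :
    IsIntegrallyClosed (MvPolynomial (Fin (r + 2)) F ⧸ Ideal.span {pHomogenization p k c}) := by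
  obtain ⟨i, hi⟩ := hsep
  obtain ⟨P, hP, hP0, hPe, hPd⟩ := exists_monic_isolate_pHomogenization p k c hk i (hc i)
  have hu : IsUnit (Polynomial.C (C (c i (k i))) : Polynomial (MvPolynomial (Fin (r + 1)) F)) :=
    (((hc i).isUnit.map C).map Polynomial.C)
  have hirr := irreducible_pHomogenization p k c hk hc h
  rw [← MulEquiv.irreducible_iff (isolate F i.succ), hPe, irreducible_isUnit_mul hu] at hirr
  have hS := isDomain_quotient_pHomogenization p k c hk hc h
  let e : (MvPolynomial (Fin (r + 2)) F ⧸ Ideal.span {pHomogenization p k c}) ≃+* AdjoinRoot P :=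
    Ideal.quotientEquiv _ _ (isolate F i.succ).toRingEquiv (by
      rw [Ideal.map_span, Set.image_singleton]
      have : Associated P (isolate F i.succ (pHomogenization p k c)) := by
        rw [hPe, mul_comm]
        exact (associated_mul_unit_right P _ hu)
      exact Ideal.span_singleton_eq_span_singleton.2 this)
  have hD : IsDomain (AdjoinRoot P) := e.symm.toMulEquiv.isDomain _
  have ht : Prime (AdjoinRoot.of P (X 0)) := by
    have h1 : e (Ideal.Quotient.mk _ (X 0)) = AdjoinRoot.of P (X 0) := by
      change AdjoinRoot.mk P (isolate F i.succ (X 0)) = _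
      rw [isolate_succ_X_zero, AdjoinRoot.mk_C]
    rw [← h1]
    exact (MulEquiv.prime_iff e).2 (prime_mk_X_zero p k c hk hc h)
  have hPdeg : P.degree ≠ 0 := fun h0 => hP0 (Polynomial.natDegree_eq_of_degree_eq_some h0)
  have hfaith : FaithfulSMul (MvPolynomial (Fin (r + 1)) F) (AdjoinRoot P) :=
    (faithfulSMul_iff_algebraMap_injective _ _).2 (AdjoinRoot.of.injective_of_degree_ne_zero hPdeg)
  have hint : IsIntegral (MvPolynomial (Fin (r + 1)) F) (AdjoinRoot.root P) :=
    ⟨P, hP, AdjoinRoot.eval₂_root P⟩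
  have hmin : minpoly (MvPolynomial (Fin (r + 1)) F) (AdjoinRoot.root P) = P := by
    have hd := minpoly.isIntegrallyClosed_dvd hint (p := P) (AdjoinRoot.eval₂_root P)
    refine Polynomial.eq_of_monic_of_associated (minpoly.monic hint) hP ?_
    exact ((minpoly.irreducible hint).associated_of_dvd hirr hd)
  have hAC : IsIntegrallyClosed (AdjoinRoot P) := by
    refine isIntegrallyClosed_of_derivative_dvd_prime_pow (A := MvPolynomial (Fin (r + 1)) F)
      AdjoinRoot.adjoinRoot_eq_top hint ht (N := p ^ k 0 - p ^ (k 0 - k i)) ?_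
    rw [hmin, hPd, Polynomial.aeval_C, map_mul, map_pow]
    have hv : IsUnit (algebraMap (MvPolynomial (Fin (r + 1)) F) (AdjoinRoot P)
        (C ((c i (k i))⁻¹ * c i 0))) :=
      ((mul_ne_zero (inv_ne_zero (hc i)) hi).isUnit.map C).map _
    exact hv.mul_left_dvd.2 dvd_rfl
  exact .of_equiv e.symm

theorem isNormalScheme_of_irreducible_principalPart (hk : Antitone k) (hc : ∀ i, c i (k i) ≠ 0)
    (hsep : ∃ i, c i 0 ≠ 0) (h : Irreducible (principalPart p k c)) :
    IsNormalScheme (weightedCompactification p k c hk) := by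
  have h1 := isDomain_quotient_pHomogenization p k c hk hc h
  have h2 := isIntegrallyClosed_quotient_pHomogenization p k c hk hc hsep h
  let _ := weightedGradedAlgebra F (pWeight p k)
  let _ := quotientGradedAlgebra (weightedHomogeneousSubmodule F (pWeight p k))
    (Ideal.span {pHomogenization p k c})
    (Ideal.homogeneous_span _ _
      (by rintro _ rfl; exact ⟨p ^ k 0, pHomogenization_isWeightedHomogeneous p k c hk⟩))
  exact isNormalScheme_proj
    (quotientGrading (weightedHomogeneousSubmodule F (pWeight p k))
      (Ideal.span {pHomogenization p k c}))

end NormalCase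

/-! ### The dichotomy: irreducible or a `p`-th power -/

section PthPower

open MvPolynomial

variable {F : Type u} [Field F] {r : ℕ} (p : ℕ) (k : Fin (r + 1) → ℕ)
  (c : Fin (r + 1) → ℕ → F)

/-- The principal part is, up to a constant, the `p`-th power of `∑ i, d i * x_i ^ p ^ (k i - 1)`. -/
def IsPthPowerPrincipalPart (a : F) (d : Fin (r + 1) → F) : Prop :=
  a ≠ 0 ∧ (∀ i, d i ≠ 0) ∧ (∀ i, k i ≠ 0) ∧ ∀ i, c i (k i) = a * d i ^ p

/-- The polynomial `∑ i, d i * x_i ^ p ^ (k i - 1)`. -/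
def principalRoot (d : Fin (r + 1) → F) : MvPolynomial (Fin (r + 1)) F :=
  ∑ i, C (d i) * X i ^ p ^ (k i - 1)

variable {p k c}

theorem IsPthPowerPrincipalPart.principalPart_eq [Fact p.Prime] [CharP F p] {a : F}
    {d : Fin (r + 1) → F} (h : IsPthPowerPrincipalPart p k c a d) :
    principalPart p k c = C a * principalRoot p k d ^ p := by
  rw [principalRoot, sum_pow_char, Finset.mul_sum, principalPart]
  refine Finset.sum_congr rfl fun i _ => ?_
  rw [h.2.2.2 i, mul_pow, ← pow_mul, ← pow_succ, Nat.sub_add_cancel (Nat.pos_of_ne_zero (h.2.2.1 i)),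
    C_mul, C_pow, mul_assoc]

theorem IsPthPowerPrincipalPart.principalRoot_ne_zero [Fact p.Prime] {a : F}
    {d : Fin (r + 1) → F} (h : IsPthPowerPrincipalPart p k c a d) : principalRoot p k d ≠ 0 := by
  intro h0
  have h1 := congr_arg (eval (Pi.single 0 1)) h0
  rw [principalRoot, map_sum, Finset.sum_eq_single 0] at h1
  · simp [h.2.1 0] at h1
  · intro i _ hi
    simp [hi, (Fact.out : p.Prime).ne_zero]
  · simp

theorem IsPthPowerPrincipalPart.not_isReduced [Fact p.Prime] [CharP F p] {a : F}
    {d : Fin (r + 1) → F} (h : IsPthPowerPrincipalPart p k c a d) :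
    ¬ _root_.IsReduced (MvPolynomial (Fin (r + 1)) F ⧸ Ideal.span {principalPart p k c}) := by
  intro hred
  have hp := (Fact.out : p.Prime)
  have hnil : IsNilpotent (Ideal.Quotient.mk (Ideal.span {principalPart p k c})
      (principalRoot p k d)) := by
    refine ⟨p, ?_⟩
    rw [← map_pow, Ideal.Quotient.eq_zero_iff_mem, Ideal.mem_span_singleton, h.principalPart_eq]
    exact (h.1.isUnit.map C).mul_left_dvd.2 dvd_rfl
  have h0 := hnil.eq_zero
  rw [Ideal.Quotient.eq_zero_iff_mem, Ideal.mem_span_singleton, h.principalPart_eq] at h0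
  obtain ⟨v, hv⟩ := h0
  -- Cancelling one factor would make the root a unit, but it vanishes at the origin.
  have h1 : 1 = C a * principalRoot p k d ^ (p - 1) * v := by
    refine mul_left_cancel₀ h.principalRoot_ne_zero ?_
    have h2 : principalRoot p k d ^ p = principalRoot p k d ^ (p - 1) * principalRoot p k d := by
      rw [← pow_succ, Nat.sub_add_cancel hp.one_le]
    rw [h2] at hv
    linear_combination hv
  have h2 := congr_arg (eval 0) h1
  have hz : eval (0 : Fin (r + 1) → F) (principalRoot p k d) = 0 := by
    rw [principalRoot, map_sum]
    exact Finset.sum_eq_zero fun i _ => by simp [hp.ne_zero]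
  have hp1 : p - 1 ≠ 0 := Nat.sub_ne_zero_of_lt hp.one_lt
  rw [map_mul, map_mul, map_pow, hz, zero_pow hp1, mul_zero, zero_mul, map_one] at h2
  exact one_ne_zero h2

variable (p k c)

theorem isolate_principalPart : isolate F 0 (principalPart p k c) =
    Polynomial.C (C (c 0 (k 0))) * Polynomial.X ^ p ^ k 0 +
      Polynomial.C (∑ l : Fin r, C (c l.succ (k l.succ)) * X l ^ p ^ k l.succ) := by
  have h1 (l : Fin r) : isolate F 0 (X l.succ) = Polynomial.C (X l) :=
    isolate_X_succAbove (F := F) 0 l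
  rw [principalPart, Fin.sum_univ_succ]
  simp only [map_add, map_mul, map_pow, map_sum, h1, isolate_C, isolate_X_self]

/-- If `∑ l, b l * x_l ^ p ^ m l` with nonzero `b l` is a `p`-th power, then so are all the `b l`,
and all the exponents are divisible by `p`. -/
theorem exists_pow_eq_coeff_of_pow_eq_sum [Fact p.Prime] {m : Fin r → ℕ} {b : Fin r → F}
    (hb : ∀ l, b l ≠ 0) {f : MvPolynomial (Fin r) F} (hf : f ^ p = ∑ l, C (b l) * X l ^ p ^ m l) (l : Fin r) :
    m l ≠ 0 ∧ ∃ d : F, d ^ p = b l := by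
  have hp := (Fact.out : p.Prime)
  -- Restriction to the `l`-th axis leaves a single monomial; its degree and leading coefficient
  -- give the two claims.
  have h1 := congr_arg (aeval (Pi.single l (Polynomial.X : Polynomial F))) hf
  rw [map_pow, map_sum, Finset.sum_eq_single l] at h1
  · simp only [map_mul, map_pow, aeval_X, Pi.single_eq_same, algHom_C,
      Polynomial.algebraMap_eq] at h1
    constructor
    · intro h0
      have h2 := congr_arg Polynomial.natDegree h1
      rw [Polynomial.natDegree_pow, Polynomial.natDegree_C_mul_X_pow _ _ (hb l), h0, pow_zero] at h2
      exact hp.one_lt.ne' (Nat.eq_one_of_mul_eq_one_right h2)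
    · have h2 := congr_arg Polynomial.leadingCoeff h1
      rw [Polynomial.leadingCoeff_pow, Polynomial.leadingCoeff_C_mul_X_pow] at h2
      exact ⟨_, h2⟩
  · intro i _ hi
    simp [hi, hp.ne_zero]
  · simp

/-- By Gauss's lemma irreducibility can be tested over the fraction field, where failure makes `B` a
`p`-th power. Its root is integral, hence a polynomial, and the coefficients can be read off. -/
theorem irreducible_or_isPthPower [Fact p.Prime] [CharP F p] (hc : ∀ i, c i (k i) ≠ 0) :
    Irreducible (principalPart p k c) ∨ ∃ a d, IsPthPowerPrincipalPart p k c a d := by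
  rw [or_iff_not_imp_left]
  intro hirr
  have hp := (Fact.out : p.Prime)
  have hu : IsUnit (Polynomial.C (C (c 0 (k 0))) : Polynomial (MvPolynomial (Fin r) F)) :=
    (((hc 0).isUnit.map C).map Polynomial.C)
  let b : Fin r → F := fun l => -((c 0 (k 0))⁻¹ * c l.succ (k l.succ))
  have hb (l) : b l ≠ 0 := neg_ne_zero.2 (mul_ne_zero (inv_ne_zero (hc 0)) (hc _))
  let A := MvPolynomial (Fin r) F
  let B : A := ∑ l : Fin r, C (b l) * X l ^ p ^ k l.succ
  have hB : isolate F 0 (principalPart p k c) =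
      Polynomial.C (C (c 0 (k 0))) * (Polynomial.X ^ p ^ k 0 - Polynomial.C B) := by
    rw [isolate_principalPart, mul_sub, sub_eq_add_neg, ← Polynomial.C_mul, ← Polynomial.C_neg]
    congr 2
    rw [Finset.mul_sum, ← Finset.sum_neg_distrib]
    refine Finset.sum_congr rfl fun l _ => ?_
    rw [← mul_assoc, ← C_mul, ← neg_mul, ← C_neg, mul_neg, neg_neg, mul_inv_cancel_left₀ (hc 0)]
  rw [← MulEquiv.irreducible_iff (isolate F 0), hB, irreducible_isUnit_mul hu,
    (Polynomial.monic_X_pow_sub_C B (pow_ne_zero _ hp.ne_zero)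
      ).irreducible_iff_irreducible_map_fraction_map (K := FractionRing A),
    Polynomial.map_sub, Polynomial.map_pow, Polynomial.map_X, Polynomial.map_C] at hirr
  have : CharP (FractionRing A) p := charP_of_injective_algebraMap
    (FaithfulSMul.algebraMap_injective A (FractionRing A)) p
  have hnot := mt (irreducible_X_pow_char_pow_sub_C p (k 0)
    (a := algebraMap A (FractionRing A) B)) hirr
  push Not at hnot
  obtain ⟨hk0, y, hy⟩ := hnot
  have hyi : IsIntegral A y := IsIntegral.of_pow hp.pos (hy ▸ isIntegral_algebraMap)
  obtain ⟨f, rfl⟩ := IsIntegrallyClosed.isIntegral_iff.1 hyi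
  rw [← map_pow] at hy
  have hf := FaithfulSMul.algebraMap_injective A (FractionRing A) hy
  choose hm d hd using exists_pow_eq_coeff_of_pow_eq_sum p hb hf
  -- Dividing by the leading coefficient makes the first root `1`; the others carry the sign from `X
  -- ^ p ^ k 0 - B`, which Frobenius respects even for `p = 2`.
  refine ⟨c 0 (k 0), Fin.cons 1 fun l => -d l, hc 0, ?_, ?_, ?_⟩
  · refine Fin.cases (by simp) fun l => ?_
    rw [Fin.cons_succ, neg_ne_zero]
    intro h0
    exact hb l (by rw [← hd, h0, zero_pow hp.ne_zero])
  · exact Fin.cases hk0 hm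
  · refine Fin.cases (by simp) fun l => ?_
    have h1 : (-d l) ^ p = -(d l ^ p) := map_neg (frobenius F p) (d l)
    rw [Fin.cons_succ, h1, hd, neg_neg, mul_inv_cancel_left₀ (hc 0)]

theorem isReduced_of_irreducible (h : Irreducible (principalPart p k c)) :
    _root_.IsReduced (MvPolynomial (Fin (r + 1)) F ⧸ Ideal.span {principalPart p k c}) := by
  have := (Ideal.span_singleton_prime h.ne_zero).2 h.prime
  infer_instance

end PthPower

/-! ### Wound groups and the exceptional case `p ^ k 0 = 2` -/

section Wound

open MvPolynomial

variable {F : Type u} [Field F] {r : ℕ}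

/-- On a wound hypersurface every polynomial curve is constant. -/
theorem IsWound.exists_eq_C {Φ : MvPolynomial (Fin (r + 1)) F}
    (h : IsWound F (MvPolynomial (Fin (r + 1)) F ⧸ Ideal.span {Φ}))
    (f : Fin (r + 1) → Polynomial F) (hf : aeval f Φ = 0) :
    ∀ i, ∃ a, f i = Polynomial.C a := by
  let φ : (MvPolynomial (Fin (r + 1)) F ⧸ Ideal.span {Φ}) →ₐ[F] Polynomial F :=
    Ideal.Quotient.liftₐ (Ideal.span {Φ}) (aeval f) (by
      intro x hx
      obtain ⟨y, rfl⟩ := Ideal.mem_span_singleton.1 hx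
      rw [map_mul, hf, zero_mul])
  obtain ⟨s, hs⟩ := h (Spec.map (CommRingCat.ofHom (φ : _ →+* Polynomial F))) (by
    rw [← Spec.map_comp, ← CommRingCat.ofHom_comp, φ.comp_algebraMap])
  obtain ⟨g, rfl⟩ := Spec.map_surjective s
  rw [← Spec.map_comp] at hs
  have h1 := Spec.map_injective hs
  intro i
  refine ⟨g.hom (Ideal.Quotient.mk _ (X i)), ?_⟩
  have h2 := congr_arg (fun q => q.hom (Ideal.Quotient.mk _ (X i))) h1
  have h3 : φ (Ideal.Quotient.mk _ (X i)) = f i := by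
    change aeval f (X i) = f i
    simp
  rw [← h3]
  exact h2

/-- All `k i` equal one and `p = 2`, so the equation is `L + a * ℓ ^ 2 = 0` with linear forms `L`
and `ℓ`. Since `r ≥ 1`, there is `v ≠ 0` with `ℓ v = 0`. If `L v = 0`, the line through `v` is a
curve in the group; otherwise, for `w` with `ℓ w = 1`, the equation on `w * X + v * q` can be solved
for `q`. -/
theorem not_isWound_of_isPthPower (hr : 1 ≤ r) (p : ℕ) [Fact p.Prime] [CharP F p]
    {k : Fin (r + 1) → ℕ} (hk : Antitone k) (hpk : p ^ k 0 = 2)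
    {c : Fin (r + 1) → ℕ → F} {a : F} {d : Fin (r + 1) → F}
    (h : IsPthPowerPrincipalPart p k c a d) :
    ¬ IsWound F (MvPolynomial (Fin (r + 1)) F ⧸ Ideal.span {pPolynomial p k c}) := by
  intro hw
  have hp := (Fact.out : p.Prime)
  have hk0 : k 0 = 1 := by
    by_contra h1
    have h2 : 2 ≤ k 0 := by have := h.2.2.1 0; omega
    have := Nat.pow_le_pow_left hp.two_le (k 0)
    have := Nat.pow_le_pow_right (n := 2) (by norm_num) h2
    omega
  have hp2 : p = 2 := by rw [hk0, pow_one] at hpk; exact hpk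
  subst hp2
  have hk1 (i) : k i = 1 := by
    have := hk (Fin.zero_le i)
    have := h.2.2.1 i
    omega
  have heval (f : Fin (r + 1) → Polynomial F) : aeval f (pPolynomial 2 k c) =
      ∑ i, Polynomial.C (c i 0) * f i + Polynomial.C a * (∑ i, Polynomial.C (d i) * f i) ^ 2 := by
    rw [pPolynomial, map_sum, sum_pow_char, Finset.mul_sum, ← Finset.sum_add_distrib]
    refine Finset.sum_congr rfl fun i _ => ?_
    have h1 := h.2.2.2 i
    rw [hk1] at h1 ⊢
    simp [Finset.sum_range_succ, h1]
    ring
  obtain ⟨m, rfl⟩ : ∃ m, r = m + 1 := ⟨r - 1, by omega⟩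
  let v : Fin (m + 1 + 1) → F := Fin.cons (d 1) (Fin.cons (- d 0) 0)
  have hsum (w e : Fin (m + 1 + 1) → F) (z : Polynomial F) :
      ∑ i, Polynomial.C (w i) * (Polynomial.C (e i) * z) = Polynomial.C (∑ i, w i * e i) * z := by
    rw [map_sum, Finset.sum_mul]
    exact Finset.sum_congr rfl fun i _ => by rw [Polynomial.C_mul]; ring
  have hv : ∑ i, d i * v i = 0 := by
    simp [v, Fin.sum_univ_succ]
    ring
  by_cases hl : ∑ i, c i 0 * v i = 0
  · obtain ⟨e, he⟩ := hw.exists_eq_C (fun i => Polynomial.C (v i) * Polynomial.X)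
      (by rw [heval, hsum, hsum, hv, hl]; simp) 0
    have h1 := congr_arg (fun q => Polynomial.coeff q 1) he
    simp [v, h.2.1 1, Polynomial.coeff_C] at h1
  · let w : Fin (m + 1 + 1) → F := Pi.single 0 (d 0)⁻¹
    have hw1 : ∑ i, d i * w i = 1 := by
      simp [w, Pi.single_apply, h.2.1 0]
    let q : Polynomial F := -(Polynomial.C (∑ i, c i 0 * v i)⁻¹) *
      (Polynomial.C a * Polynomial.X ^ 2 + Polynomial.C (∑ i, c i 0 * w i) * Polynomial.X)
    have hq : Polynomial.C (∑ i, c i 0 * v i) * q =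
        -(Polynomial.C a * Polynomial.X ^ 2 + Polynomial.C (∑ i, c i 0 * w i) * Polynomial.X) := by
      have : Polynomial.C (∑ i, c i 0 * v i) * Polynomial.C (∑ i, c i 0 * v i)⁻¹ = 1 := by
        rw [← Polynomial.C_mul, mul_inv_cancel₀ hl, Polynomial.C_1]
      linear_combination (-(Polynomial.C a * Polynomial.X ^ 2 +
        Polynomial.C (∑ i, c i 0 * w i) * Polynomial.X)) * this
    have hX : ∑ i, Polynomial.C (d i) * (Polynomial.C (w i) * Polynomial.X + Polynomial.C (v i) * q)
        = Polynomial.X := by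
      simp only [mul_add, Finset.sum_add_distrib]
      rw [hsum, hsum, hv, hw1]
      simp
    have hcon := hw.exists_eq_C
      (fun i => Polynomial.C (w i) * Polynomial.X + Polynomial.C (v i) * q) (by
        rw [heval, hX]
        simp only [mul_add, Finset.sum_add_distrib]
        rw [hsum, hsum, hq]
        ring)
    -- Constant coordinates would make `ℓ` constant along the curve, where it equals `X`.
    choose e he using hcon
    simp only [he] at hX
    have h1 := congr_arg (fun q => Polynomial.coeff q 1) hX
    simp at h1

end Wound

/-! ### A `p`-th power principal part prevents normality -/

/-- In an integrally closed homogeneous localization, a relation `g ^ p = t ^ N * h` between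
homogeneous elements, with `t` of degree one, forces `t` to divide `g ^ (p - 1)`. -/
theorem HomogeneousLocalization.exists_dvd_mul_pow {R A : Type u} [CommRing R] [CommRing A]
    [Algebra R A] (𝒜 : ℕ → Submodule R A) [GradedAlgebra 𝒜] (P : Ideal A) [P.IsPrime]
    [IsDomain (HomogeneousLocalization.AtPrime 𝒜 P)]
    [IsIntegrallyClosed (HomogeneousLocalization.AtPrime 𝒜 P)]
    {t x g h : A} {D N p : ℕ} (ht : t ∈ 𝒜 1) (hx : x ∈ 𝒜 1) (hxP : x ∉ P) (hg : g ∈ 𝒜 D)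
    (hh : h ∈ 𝒜 D) (hp : p ≠ 0) (hND : N + D = p * D) (hN : p ≤ N * (p - 1))
    (hrel : g ^ p = t ^ N * h) : ∃ u, u ∉ P ∧ t ∣ u * g ^ (p - 1) := by
  have hxD : x ^ D ∈ 𝒜 D := by
    have := SetLike.pow_mem_graded D hx
    rwa [smul_eq_mul, mul_one] at this
  have hxDP : x ^ D ∈ P.primeCompl := P.primeCompl.pow_mem hxP D
  let τ : HomogeneousLocalization.AtPrime 𝒜 P := .mk ⟨1, ⟨t, ht⟩, ⟨x, hx⟩, hxP⟩
  let γ : HomogeneousLocalization.AtPrime 𝒜 P := .mk ⟨D, ⟨g, hg⟩, ⟨x ^ D, hxD⟩, hxDP⟩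
  let η : HomogeneousLocalization.AtPrime 𝒜 P := .mk ⟨D, ⟨h, hh⟩, ⟨x ^ D, hxD⟩, hxDP⟩
  have hγ : γ ^ p = τ ^ N * η := by
    refine HomogeneousLocalization.val_injective P.primeCompl ?_
    simp only [γ, τ, η, HomogeneousLocalization.val_mul, HomogeneousLocalization.val_pow,
      HomogeneousLocalization.val_mk, Localization.mk_pow, Localization.mk_mul]
    congr 1
    refine Subtype.ext ?_
    simp only [Submonoid.coe_mul, SubmonoidClass.coe_pow]
    rw [← pow_mul, ← pow_add, hND, mul_comm]
  -- In an integrally closed domain divisibility may be tested on `p`-th powers, and `(γ ^ (p - 1))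
  -- ^ p = τ ^ (N * (p - 1)) * η ^ (p - 1)`.
  have hdvd : τ ∣ γ ^ (p - 1) := by
    rw [← IsIntegrallyClosed.pow_dvd_pow_iff hp, ← pow_mul, mul_comm, pow_mul, hγ, mul_pow,
      ← pow_mul]
    exact (pow_dvd_pow τ hN).mul_right _
  obtain ⟨z, hz⟩ := hdvd
  have hz' := congr_arg HomogeneousLocalization.val hz
  obtain ⟨s, u, hsu⟩ := IsLocalization.exists_mk'_eq P.primeCompl z.val
  rw [HomogeneousLocalization.val_mul, ← hsu, HomogeneousLocalization.val_pow] at hz'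
  simp only [γ, τ, HomogeneousLocalization.val_mk, Localization.mk_pow] at hz'
  simp only [Localization.mk_eq_mk'] at hz'
  rw [← IsLocalization.mk'_mul, IsLocalization.mk'_eq_iff_eq, IsLocalization.eq_iff_exists
    P.primeCompl] at hz'
  obtain ⟨w, hw⟩ := hz'
  simp only [Submonoid.coe_mul, SubmonoidClass.coe_pow] at hw
  -- The factor `w` is needed because `A` is not assumed to be a domain.
  refine ⟨w * (x * u), P.primeCompl.mul_mem w.2 (P.primeCompl.mul_mem hxP u.2), ?_⟩
  exact ⟨w * ((x ^ D) ^ (p - 1) * s), by linear_combination hw⟩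

section NonNormalCase

open MvPolynomial

variable {F : Type u} [Field F] {r : ℕ} (p : ℕ) (k : Fin (r + 1) → ℕ) (c : Fin (r + 1) → ℕ → F)

/-- The root of the principal part in the homogeneous coordinates. -/
def homogeneousRoot (d : Fin (r + 1) → F) : MvPolynomial (Fin (r + 2)) F :=
  ∑ i : Fin (r + 1), C (d i) * X i.succ ^ p ^ (k i - 1)

/-- The non-principal part of the homogenization, divided by a power of `t_0`. -/
def homogeneousRest : MvPolynomial (Fin (r + 2)) F :=
  ∑ i : Fin (r + 1), ∑ j ∈ Finset.range (k i),
    C (c i j) * X 0 ^ (p ^ (k 0 - 1) - p ^ (k 0 - k i + j)) * X i.succ ^ p ^ j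

@[simp] theorem killZero_homogeneousRoot (d : Fin (r + 1) → F) :
    killZero F (r + 1) (homogeneousRoot p k d) = principalRoot p k d := by
  simp [homogeneousRoot, principalRoot]

theorem homogeneousRoot_isWeightedHomogeneous (hk : Antitone k) (hk0 : ∀ i, k i ≠ 0)
    (d : Fin (r + 1) → F) :
    IsWeightedHomogeneous (pWeight p k) (homogeneousRoot p k d) (p ^ (k 0 - 1)) := by
  refine IsWeightedHomogeneous.sum _ _ _ fun i _ => ?_
  have hki : k i ≤ k 0 := hk (Fin.zero_le i)
  have hi : IsWeightedHomogeneous (pWeight p k) (X i.succ : MvPolynomial (Fin (r + 2)) F)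
      (p ^ (k 0 - k i)) :=
    isWeightedHomogeneous_X F (pWeight p k) i.succ
  have h := (hi.pow (p ^ (k i - 1))).C_mul (d i)
  have := hk0 i
  rwa [smul_eq_mul, ← pow_add, show k i - 1 + (k 0 - k i) = k 0 - 1 by omega] at h

theorem homogeneousRest_isWeightedHomogeneous [Fact p.Prime] (hk : Antitone k) :
    IsWeightedHomogeneous (pWeight p k) (homogeneousRest p k c) (p ^ (k 0 - 1)) := by
  refine IsWeightedHomogeneous.sum _ _ _ fun i _ => IsWeightedHomogeneous.sum _ _ _ fun j hj => ?_
  have hki : k i ≤ k 0 := hk (Fin.zero_le i)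
  have hj' : j < k i := Finset.mem_range.1 hj
  have h0 : IsWeightedHomogeneous (pWeight p k) (X 0 : MvPolynomial (Fin (r + 2)) F) 1 :=
    isWeightedHomogeneous_X F (pWeight p k) 0
  have hi : IsWeightedHomogeneous (pWeight p k) (X i.succ : MvPolynomial (Fin (r + 2)) F)
      (p ^ (k 0 - k i)) :=
    isWeightedHomogeneous_X F (pWeight p k) i.succ
  have h := ((h0.pow (p ^ (k 0 - 1) - p ^ (k 0 - k i + j))).C_mul (c i j)).mul (hi.pow (p ^ j))
  have hle : p ^ (k 0 - k i + j) ≤ p ^ (k 0 - 1) :=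
    Nat.pow_le_pow_right (Fact.out : p.Prime).pos (by omega)
  have hdeg : (p ^ (k 0 - 1) - p ^ (k 0 - k i + j)) • 1 + p ^ j • p ^ (k 0 - k i) =
      p ^ (k 0 - 1) := by
    rw [smul_eq_mul, smul_eq_mul, mul_one, ← pow_add, add_comm j]
    omega
  rwa [hdeg] at h

variable {p k c}

theorem IsPthPowerPrincipalPart.pHomogenization_eq [Fact p.Prime] [CharP F p] (hk : Antitone k)
    {a : F} {d : Fin (r + 1) → F} (h : IsPthPowerPrincipalPart p k c a d) :
    pHomogenization p k c = C a * homogeneousRoot p k d ^ p +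
      X 0 ^ (p ^ k 0 - p ^ (k 0 - 1)) * homogeneousRest p k c := by
  rw [homogeneousRoot, homogeneousRest, sum_pow_char, Finset.mul_sum, Finset.mul_sum,
    ← Finset.sum_add_distrib, pHomogenization]
  refine Finset.sum_congr rfl fun i _ => ?_
  have hki : k i ≤ k 0 := hk (Fin.zero_le i)
  rw [Finset.sum_range_succ]
  refine (add_comm _ _).trans (congr_arg₂ _ ?_ ?_)
  · rw [Nat.sub_add_cancel hki, Nat.sub_self, pow_zero, mul_one, h.2.2.2 i, mul_pow, ← pow_mul,
      ← pow_succ, Nat.sub_add_cancel (Nat.pos_of_ne_zero (h.2.2.1 i)), C_mul, C_pow, mul_assoc]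
  · rw [Finset.mul_sum]
    refine Finset.sum_congr rfl fun j hj => ?_
    have hj' : j < k i := Finset.mem_range.1 hj
    have hle : p ^ (k 0 - k i + j) ≤ p ^ (k 0 - 1) :=
      Nat.pow_le_pow_right (Fact.out : p.Prime).pos (by omega)
    have hle' : p ^ (k 0 - 1) ≤ p ^ k 0 :=
      Nat.pow_le_pow_right (Fact.out : p.Prime).pos (by omega)
    rw [show p ^ k 0 - p ^ (k 0 - k i + j) = (p ^ k 0 - p ^ (k 0 - 1)) +
      (p ^ (k 0 - 1) - p ^ (k 0 - k i + j)) by omega, pow_add]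
    ring

/-- The root of the principal part vanishes at some point, over an algebraic closure, whose
first coordinate is one. -/
theorem exists_aeval_principalRoot_eq_zero (hr : 1 ≤ r) [Fact p.Prime] {d : Fin (r + 1) → F}
    (hd : ∀ i, d i ≠ 0) :
    ∃ v : Fin (r + 1) → AlgebraicClosure F, v 0 = 1 ∧ aeval v (principalRoot p k d) = 0 := by
  have hp := (Fact.out : p.Prime)
  obtain ⟨m, rfl⟩ : ∃ m, r = m + 1 := ⟨r - 1, by omega⟩
  obtain ⟨ξ, hξ⟩ := IsAlgClosed.exists_pow_nat_eq
    (algebraMap F (AlgebraicClosure F) (-(d 0 / d 1))) (n := p ^ (k 1 - 1)) (Nat.pow_pos hp.pos)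
  refine ⟨Fin.cons 1 (Fin.cons ξ 0), rfl, ?_⟩
  have h1 : algebraMap F (AlgebraicClosure F) (d 1) * ξ ^ p ^ (k 1 - 1) =
      -algebraMap F (AlgebraicClosure F) (d 0) := by
    rw [hξ, ← map_mul, ← map_neg]
    congr 1
    have := hd 1
    field_simp
  rw [principalRoot, Fin.sum_univ_succ, Fin.sum_univ_succ]
  simp [hp.ne_zero, h1]

/-- The obstruction sits at a point with `t_0 = G = 0` and `t_1 = 1`, where `G` is the homogeneous
root; `t_1` has weight one and serves as denominator. -/
theorem IsPthPowerPrincipalPart.not_isNormalScheme (hr : 1 ≤ r) [Fact p.Prime] [CharP F p]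
    (hk : Antitone k) (hpk : p ^ k 0 ≠ 2) {a : F} {d : Fin (r + 1) → F}
    (h : IsPthPowerPrincipalPart p k c a d) :
    ¬ IsNormalScheme (weightedCompactification p k c hk) := by
  have hp := (Fact.out : p.Prime)
  set I := Ideal.span {pHomogenization p k c}
  let _ := weightedGradedAlgebra F (pWeight p k)
  have hIh : I.IsHomogeneous (weightedHomogeneousSubmodule F (pWeight p k)) :=
    Ideal.homogeneous_span _ _
      (by rintro _ rfl; exact ⟨p ^ k 0, pHomogenization_isWeightedHomogeneous p k c hk⟩)
  let _ := quotientGradedAlgebra (weightedHomogeneousSubmodule F (pWeight p k)) I hIh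
  intro hnorm
  let 𝒜 := quotientGrading (weightedHomogeneousSubmodule F (pWeight p k)) I
  change IsNormalScheme (Proj 𝒜) at hnorm
  have hmem {f : MvPolynomial (Fin (r + 2)) F} {n : ℕ}
      (hf : IsWeightedHomogeneous (pWeight p k) f n) : Ideal.Quotient.mk I f ∈ 𝒜 n := ⟨f, hf, rfl⟩
  have hkz := h.2.2.1 0
  have hlt : p ^ (k 0 - 1) < p ^ k 0 := Nat.pow_lt_pow_right hp.one_lt (by omega)
  have hN0 : p ^ k 0 - p ^ (k 0 - 1) ≠ 0 := by omega
  have hGw := homogeneousRoot_isWeightedHomogeneous p k hk h.2.2.1 d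
  have hHw := homogeneousRest_isWeightedHomogeneous p k c hk
  have hX0w : IsWeightedHomogeneous (pWeight p k) (X 0 : MvPolynomial (Fin (r + 2)) F) 1 :=
    isWeightedHomogeneous_X F (pWeight p k) 0
  have hX1w : IsWeightedHomogeneous (pWeight p k) (X 1 : MvPolynomial (Fin (r + 2)) F) 1 := by
    have := isWeightedHomogeneous_X F (pWeight p k) (Fin.succ 0)
    rwa [pWeight, Fin.cons_succ, Nat.sub_self, pow_zero] at this
  obtain ⟨v, hv0, hv⟩ := exists_aeval_principalRoot_eq_zero (p := p) (k := k) hr h.2.1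
  let α : MvPolynomial (Fin (r + 2)) F →ₐ[F] AlgebraicClosure F :=
    (aeval v).comp (killZero F (r + 1))
  have hαG : α (homogeneousRoot p k d) = 0 := by
    simp [α, hv]
  have hαX : α (X 0) = 0 := by simp [α]
  have hαX1 : α (X 1) = 1 := by
    change aeval v (killZero F (r + 1) (X (Fin.succ 0))) = 1
    rw [killZero_X_succ, aeval_X, hv0]
  let φ : (MvPolynomial (Fin (r + 2)) F ⧸ I) →+* AlgebraicClosure F :=
    Ideal.Quotient.lift I (α : _ →+* AlgebraicClosure F) (by
      intro x hx
      obtain ⟨y, rfl⟩ := Ideal.mem_span_singleton.1 hx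
      rw [map_mul, h.pHomogenization_eq hk]
      simp [hαG, hαX, hN0, hp.ne_zero])
  -- The kernel of evaluation at an affine representative need not be homogeneous; its homogeneous
  -- core is the prime of the corresponding point of `Proj`.
  let P : Ideal (MvPolynomial (Fin (r + 2)) F ⧸ I) :=
    ((RingHom.ker φ).homogeneousCore 𝒜).toIdeal
  have hPprime : P.IsPrime := (RingHom.ker_isPrime φ).homogeneousCore
  have hX1P : Ideal.Quotient.mk I (X 1) ∉ P := fun hmem' => by
    have h1 : α (X 1) = 0 := Ideal.toIdeal_homogeneousCore_le 𝒜 (RingHom.ker φ) hmem'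
    rw [hαX1] at h1
    exact one_ne_zero h1
  have hX0P : Ideal.Quotient.mk I (X 0) ∈ P :=
    Ideal.mem_homogeneousCore_of_homogeneous_of_mem ⟨1, hmem hX0w⟩ hαX
  have hGP : Ideal.Quotient.mk I (homogeneousRoot p k d) ∈ P :=
    Ideal.mem_homogeneousCore_of_homogeneous_of_mem ⟨_, hmem hGw⟩ hαG
  obtain ⟨_, _⟩ := hnorm.homogeneousLocalization 𝒜 P (HomogeneousIdeal.isHomogeneous _)
    (fun hle => hX1P (hle (HomogeneousIdeal.mem_irrelevant_of_mem 𝒜 one_pos (hmem hX1w))))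
  have hpow : p ^ k 0 = p * p ^ (k 0 - 1) := by
    rw [← pow_succ', Nat.sub_add_cancel (by omega)]
  -- This is where `p ^ k 0 ≠ 2` enters: for `p = 2` the bound needs `k 0 ≥ 2`, while for `p ≥ 3` it
  -- follows from `(p - 1) ^ 2 ≥ p`.
  have hN : p ≤ (p ^ k 0 - p ^ (k 0 - 1)) * (p - 1) := by
    have h1 : p ^ k 0 - p ^ (k 0 - 1) = p ^ (k 0 - 1) * (p - 1) := by
      rw [Nat.mul_sub_one, mul_comm, ← hpow]
    rw [h1]
    obtain ⟨q, rfl⟩ : ∃ q, p = q + 2 := ⟨p - 2, by have := hp.two_le; omega⟩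
    rw [show q + 2 - 1 = q + 1 by omega]
    rcases Nat.eq_zero_or_pos q with rfl | hq
    · have : k 0 ≠ 1 := fun h1 => hpk (by rw [h1]; rfl)
      have := Nat.pow_le_pow_right (n := 2) (by norm_num) (show 1 ≤ k 0 - 1 by omega)
      simpa using this
    · have h2 : 1 ≤ (q + 2) ^ (k 0 - 1) := Nat.one_le_pow _ _ (by omega)
      have h3 : (q + 1) * (q + 1) ≤ (q + 2) ^ (k 0 - 1) * (q + 1) * (q + 1) := by
        rw [mul_assoc]; exact Nat.le_mul_of_pos_left _ h2
      nlinarith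
  have hrel : Ideal.Quotient.mk I (homogeneousRoot p k d) ^ p =
      Ideal.Quotient.mk I (X 0) ^ (p ^ k 0 - p ^ (k 0 - 1)) *
        Ideal.Quotient.mk I (C (-a⁻¹) * homogeneousRest p k c) := by
    rw [← map_pow, ← map_pow, ← map_mul, Ideal.Quotient.eq, Ideal.mem_span_singleton]
    refine ⟨C a⁻¹, ?_⟩
    rw [h.pHomogenization_eq hk, C_neg]
    have : (C a * C a⁻¹ : MvPolynomial (Fin (r + 2)) F) = 1 := by
      rw [← C_mul, mul_inv_cancel₀ h.1, C_1]
    linear_combination (-homogeneousRoot p k d ^ p) * this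
  obtain ⟨u, huP, hu⟩ := HomogeneousLocalization.exists_dvd_mul_pow 𝒜 P (hmem hX0w) (hmem hX1w)
    hX1P (hmem hGw) (hmem (hHw.C_mul (-a⁻¹))) hp.ne_zero (by omega) hN hrel
  obtain ⟨U, rfl⟩ := Ideal.Quotient.mk_surjective u
  obtain ⟨w, hw⟩ := hu
  obtain ⟨W, rfl⟩ := Ideal.Quotient.mk_surjective w
  rw [← map_pow, ← map_mul, ← map_mul, Ideal.Quotient.eq, Ideal.mem_span_singleton] at hw
  obtain ⟨V, hV⟩ := hw
  have hψ := congr_arg (killZero F (r + 1)) hV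
  simp only [map_sub, map_mul, map_pow, killZero_homogeneousRoot, killZero_X_zero, zero_mul,
    sub_zero, killZero_pHomogenization p k c hk, h.principalPart_eq] at hψ
  -- At `t_0 = 0` the relation reads `U * G ^ (p - 1) = a * G ^ p * V`. Cancelling puts `U` in the
  -- ideal generated by `t_0` and `G`, which maps into `P`, although the class of `U` is outside
  -- `P`.
  have hψ' : killZero F (r + 1) U = C a * principalRoot p k d * killZero F (r + 1) V := by
    refine mul_right_cancel₀ (pow_ne_zero (p - 1) h.principalRoot_ne_zero) ?_
    have h2 : principalRoot p k d ^ p = principalRoot p k d ^ (p - 1) * principalRoot p k d := by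
      rw [← pow_succ, Nat.sub_add_cancel hp.one_le]
    rw [h2] at hψ
    linear_combination hψ
  obtain ⟨Y, hY⟩ : X 0 ∣ U - C a * homogeneousRoot p k d * V :=
    X_zero_dvd_of_killZero_eq_zero (by simp [hψ'])
  refine huP ?_
  rw [show U = X 0 * Y + C a * homogeneousRoot p k d * V by rw [← hY]; ring, map_add, map_mul,
    map_mul, map_mul]
  exact P.add_mem (P.mul_mem_right _ hX0P) (P.mul_mem_right _ (P.mul_mem_left _ hGP))

end NonNormalCase

end

theorem mainTheorem12 {F : Type u} [Field F] (p : ℕ) [Fact p.Prime] [CharP F p]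
    (r : ℕ) (hr : 1 ≤ r)
    (k : Fin (r + 1) → ℕ) (hk : Antitone k)
    (c : Fin (r + 1) → ℕ → F) (hc : ∀ i, c i (k i) ≠ 0)
    (hsep : ∃ i, c i 0 ≠ 0)
    (hwound : p ^ k 0 = 2 →
      IsWound F (MvPolynomial (Fin (r + 1)) F ⧸ Ideal.span {pPolynomial p k c})) :
    (IsNormalScheme (weightedCompactification p k c hk) ↔
      _root_.IsReduced (MvPolynomial (Fin (r + 1)) F ⧸ Ideal.span {principalPart p k c})) ∧
    (IsNormalScheme (weightedCompactification p k c hk) ↔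
      Irreducible (principalPart p k c)) := by
  rcases irreducible_or_isPthPower p k c hc with h | ⟨a, d, h⟩
  · have h1 := isNormalScheme_of_irreducible_principalPart p k c hk hc hsep h
    exact ⟨iff_of_true h1 (isReduced_of_irreducible p k c h), iff_of_true h1 h⟩
  · have h1 := h.not_isNormalScheme hr hk
      fun hpk => not_isWound_of_isPthPower hr p hk hpk h (hwound hpk)
    exact ⟨iff_of_false h1 h.not_isReduced,
      iff_of_false h1 fun hi => h.not_isReduced (isReduced_of_irreducible p k c hi)⟩
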